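/- Let \(\widetilde C_1,\widetilde C_2\) be the qubit amplitude-damping channels with decay parameters \(\gamma_1=0.37\) and \(\gamma_2=0.87\), where the channel with parameter \(\gamma\) is \(\rho\mapsto K_0\rho K_0^\dagger+K_1\rho K_1^\dagger\) with \(K_0=|0\rangle\langle 0|+\sqrt{1-\gamma}\,|1\rangle\langle 1|\) and \(K_1=\sqrt{\gamma}\,|0\rangle\langle 1|\). Let \(C_i=\sum_{k,l}|k\rangle\langle l|\otimes\widetilde C_i(|k\rangle\langle l|)\) be their Choi operators, on (input) \(\otimes\) (output). Let \(I_1,O_1,I_2,O_2\) be qubit spaces (input and output of slots 1 and 2), and for a set \(X\) of them write \({}_XA=\mathrm{Tr}_XA\otimes\mathbb 1^X/d_X\), where \(d_X\) is the dimension of the tensor product of the spaces in \(X\). Consider positive semidefinite operators \(W\) on \(I_1\otimes O_1\otimes I_2\otimes O_2\) with \(\mathrm{Tr}\,W=d_{O_1}d_{O_2}=4\). Such a \(W\) is - a parallel (PAR) process if \(W={}_{O_1O_2}W\); - a sequential (SEQ) process, with slot 1 before slot 2, if \(W={}_{O_2}W\) and \({}_{I_2O_2}W={}_{O_1I_2O_2}W\);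 - a separable (SEP) process if \(W=qW^{1\prec2}+(1-q)W^{2\prec1}\) for some \(0\le q\le1\), where \(W^{1\prec2}\) is a sequential process and \(W^{2\prec1}\) is a sequential process with the roles of the two slots exchanged; - a general (GEN) process if \({}_{I_1O_1}W={}_{I_1O_1O_2}W\), \({}_{I_2O_2}W={}_{O_1I_2O_2}W\) and \(W={}_{O_1}W+{}_{O_2}W-{}_{O_1O_2}W\). For \(\mathcal S\in\{\mathrm{PAR},\mathrm{SEQ},\mathrm{SEP},\mathrm{GEN}\}\), a tester of class \(\mathcal S\) is a pair \((T_1,T_2)\) of positive semidefinite operators such that \(T_1+T_2\) is a process of class \(\mathcal S\), and \[ P^{\mathcal S}=\max_{(T_1,T_2)}\ \sum_{i=1}^{2}\tfrac12\,\mathrm{Tr}\bigl(T_i\,(C_i\otimes C_i)\bigr), \] the maximum over all testers of class \(\mathcal S\), is the maximal probability of discriminating the two equiprobable channels with two copies. Then these maxima exist, \(P^{\mathrm{PAR}}<P^{\mathrm{SEQ}}<P^{\mathrm{SEP}}<P^{\mathrm{GEN}}\), and \[ \tfrac{8101}{10000}<P^{\mathrm{PAR}}<\tfrac{8102}{10000},\qquad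 \tfrac{8161}{10000}<P^{\mathrm{SEQ}}<\tfrac{8162}{10000}, \] \[ \tfrac{8166}{10000}<P^{\mathrm{SEP}}<\tfrac{81665}{100000},\qquad \tfrac{8167}{10000}<P^{\mathrm{GEN}}<\tfrac{8168}{10000}. \] -/

import Mathlib

open scoped Matrix Kronecker ComplexOrder

noncomputable section

namespace ChannelDiscrimination

/-- The linear map `ρ ↦ ∑ k, K k * ρ * (K k)ᴴ` with Kraus operators `K k`. -/
def krausMap {κ I O : Type*} [Fintype κ] [Fintype I] (K : κ → Matrix O I ℂ) :
    Matrix I I ℂ →ₗ[ℂ] Matrix O O ℂ where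
  toFun ρ := ∑ k, K k * ρ * (K k)ᴴ
  map_add' ρ σ := by
    simp [Matrix.mul_add, Matrix.add_mul, Finset.sum_add_distrib]
  map_smul' c ρ := by
    simp [Finset.smul_sum]

/-- The qubit amplitude-damping channel with decay parameter `γ ∈ [0, 1]`: its Kraus operators are
`|0⟩⟨0| + √(1 - γ) |1⟩⟨1|` and `√γ |0⟩⟨1|`. -/
def amplitudeDamping (γ : ℝ) : Matrix (Fin 2) (Fin 2) ℂ →ₗ[ℂ] Matrix (Fin 2) (Fin 2) ℂ :=
  krausMap ![!![1, 0; 0, ((√(1 - γ) : ℝ) : ℂ)], !![0, ((√γ : ℝ) : ℂ); 0, 0]]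

/-- The Choi operator `∑ i i', |i⟩⟨i'| ⊗ Φ(|i⟩⟨i'|)` of a linear map `Φ`. -/
def choi {I O : Type*} [DecidableEq I] (Φ : Matrix I I ℂ →ₗ[ℂ] Matrix O O ℂ) :
    Matrix (I × O) (I × O) ℂ :=
  Matrix.of fun a b => Φ (Matrix.single a.1 b.1 1) a.2 b.2

/-- Linear operators on the tensor product of the spaces `I₁`, `O₁`, `I₂`, `O₂`
(first slot: input `I₁`, output `O₁`; second slot: input `I₂`, output `O₂`). -/
abbrev Op (I₁ O₁ I₂ O₂ : Type*) : Type _ :=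
  Matrix ((I₁ × O₁) × (I₂ × O₂)) ((I₁ × O₁) × (I₂ × O₂)) ℂ

section TraceAndReplace

variable {I₁ O₁ I₂ O₂ : Type*}

/-- Trace-and-replace on `I₁`: trace out `I₁` and put `1 / d` on it, with `d` its dimension.
The operations on several systems are obtained by composition. -/
def replI₁ [Fintype I₁] [DecidableEq I₁] (A : Op I₁ O₁ I₂ O₂) : Op I₁ O₁ I₂ O₂ :=
  Matrix.of fun a b =>
    if a.1.1 = b.1.1 then
      (Fintype.card I₁ : ℂ)⁻¹ * ∑ x : I₁, A ((x, a.1.2), a.2) ((x, b.1.2), b.2)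
    else 0

/-- Trace-and-replace on `O₁`. -/
def replO₁ [Fintype O₁] [DecidableEq O₁] (A : Op I₁ O₁ I₂ O₂) : Op I₁ O₁ I₂ O₂ :=
  Matrix.of fun a b =>
    if a.1.2 = b.1.2 then
      (Fintype.card O₁ : ℂ)⁻¹ * ∑ x : O₁, A ((a.1.1, x), a.2) ((b.1.1, x), b.2)
    else 0

/-- Trace-and-replace on `I₂`. -/
def replI₂ [Fintype I₂] [DecidableEq I₂] (A : Op I₁ O₁ I₂ O₂) : Op I₁ O₁ I₂ O₂ :=
  Matrix.of fun a b =>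
    if a.2.1 = b.2.1 then
      (Fintype.card I₂ : ℂ)⁻¹ * ∑ x : I₂, A (a.1, (x, a.2.2)) (b.1, (x, b.2.2))
    else 0

/-- Trace-and-replace on `O₂`. -/
def replO₂ [Fintype O₂] [DecidableEq O₂] (A : Op I₁ O₁ I₂ O₂) : Op I₁ O₁ I₂ O₂ :=
  Matrix.of fun a b =>
    if a.2.2 = b.2.2 then
      (Fintype.card O₂ : ℂ)⁻¹ * ∑ x : O₂, A (a.1, (a.2.1, x)) (b.1, (b.2.1, x))
    else 0

end TraceAndReplace

section Processes

variable {I₁ O₁ I₂ O₂ : Type*} [Fintype I₁] [Fintype O₁] [Fintype I₂] [Fintype O₂]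
  [DecidableEq I₁] [DecidableEq O₁] [DecidableEq I₂] [DecidableEq O₂]

/-- The normalization common to all classes of processes: a positive semidefinite operator of
trace `d_{O₁} d_{O₂}`. -/
def IsNormalized (W : Op I₁ O₁ I₂ O₂) : Prop :=
  W.PosSemidef ∧ W.trace = (Fintype.card O₁ : ℂ) * (Fintype.card O₂ : ℂ)

/-- Parallel processes. -/
def IsParallelProcess (W : Op I₁ O₁ I₂ O₂) : Prop :=
  IsNormalized W ∧ W = replO₁ (replO₂ W)

/-- Sequential processes in which slot `1` comes before slot `2`. -/
def IsSequentialProcess (W : Op I₁ O₁ I₂ O₂) : Prop :=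
  IsNormalized W ∧ W = replO₂ W ∧ replI₂ (replO₂ W) = replO₁ (replI₂ (replO₂ W))

/-- Sequential processes in which slot `2` comes before slot `1`. -/
def IsSequentialProcess' (W : Op I₁ O₁ I₂ O₂) : Prop :=
  IsNormalized W ∧ W = replO₁ W ∧ replI₁ (replO₁ W) = replO₂ (replI₁ (replO₁ W))

/-- Separable processes: convex mixtures of sequential processes of the two orders. -/
def IsSeparableProcess (W : Op I₁ O₁ I₂ O₂) : Prop :=
  IsNormalized W ∧ ∃ (q : ℝ) (W₁₂ W₂₁ : Op I₁ O₁ I₂ O₂), 0 ≤ q ∧ q ≤ 1 ∧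
    IsSequentialProcess W₁₂ ∧ IsSequentialProcess' W₂₁ ∧
    W = (q : ℂ) • W₁₂ + ((1 - q : ℝ) : ℂ) • W₂₁

/-- General processes. -/
def IsGeneralProcess (W : Op I₁ O₁ I₂ O₂) : Prop :=
  IsNormalized W ∧
    replI₁ (replO₁ W) = replI₁ (replO₁ (replO₂ W)) ∧
    replI₂ (replO₂ W) = replO₁ (replI₂ (replO₂ W)) ∧
    W = replO₁ W + replO₂ W - replO₁ (replO₂ W)

/-- The four classes of strategies. -/
inductive Strategy
  | par
  | seq
  | sep
  | gen

/-- The processes of a given class. -/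
def IsProcess (S : Strategy) (W : Op I₁ O₁ I₂ O₂) : Prop :=
  match S with
  | .par => IsParallelProcess W
  | .seq => IsSequentialProcess W
  | .sep => IsSeparableProcess W
  | .gen => IsGeneralProcess W

/-- Two-copy testers of a given class. -/
def IsTester {ι : Type*} [Fintype ι] (S : Strategy) (T : ι → Op I₁ O₁ I₂ O₂) : Prop :=
  (∀ i, (T i).PosSemidef) ∧ IsProcess S (∑ i, T i)

end Processes

section Success

variable {ι I O : Type*} [Fintype ι] [Fintype I] [Fintype O] [DecidableEq I] [DecidableEq O]

/-- The probability `∑ i, p i * Tr (T i * (C i ⊗ C i))` of guessing the channel correctly with the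
tester `T`, where channel `i` has probability `p i` and Choi operator `C i`. (Each trace is real for
positive semidefinite operators; `re` only moves it from `ℂ` to `ℝ`.) -/
def successProbability (p : ι → ℝ) (Φ : ι → Matrix I I ℂ →ₗ[ℂ] Matrix O O ℂ)
    (T : ι → Op I O I O) : ℝ :=
  ∑ i, p i * (T i * (choi (Φ i) ⊗ₖ choi (Φ i))).trace.re

/-- The success probabilities that two-copy testers of class `S` reach. -/
def successProbabilities (S : Strategy) (p : ι → ℝ)
    (Φ : ι → Matrix I I ℂ →ₗ[ℂ] Matrix O O ℂ) : Set ℝ :=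
  {r | ∃ T : ι → Op I O I O, IsTester S T ∧ r = successProbability p Φ T}

/-- The maximal probability of success with two copies under strategy class `S`. -/
def maxSuccess (S : Strategy) (p : ι → ℝ) (Φ : ι → Matrix I I ℂ →ₗ[ℂ] Matrix O O ℂ) : ℝ :=
  sSup (successProbabilities S p Φ)

end Success

/-- The two amplitude-damping channels with decay parameters `0.37` and `0.87`. -/
def twoDampings : Fin 2 → Matrix (Fin 2) (Fin 2) ℂ →ₗ[ℂ] Matrix (Fin 2) (Fin 2) ℂ :=
  ![amplitudeDamping (37 / 100), amplitudeDamping (87 / 100)]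

/-- `P^S` for the two channels above, each with probability `1 / 2`. -/
def P (S : Strategy) : ℝ := maxSuccess S (fun _ => 1 / 2) twoDampings

end ChannelDiscrimination

end

/-!
Each maximum is the value of a semidefinite program. It is bounded from below by an explicit tester
and from above by weak duality: if `X` dominates `Cᵢ ⊗ Cᵢ / 2` for both `i`, then every tester with
process `W` succeeds with probability at most `Tr (W X)`, and this is constant on the processes of
a class as soon as the adjoint of a projection onto their span maps `X` to a multiple of the
identity. For separable processes `X` is chosen invariant under the exchange of the slots, so that
only sequential processes in one order have to be considered.

Amplitude damping commutes with phase rotations, so all certificates may be taken real and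
phase-invariant; such operators split into blocks of size at most four, whose positivity is decided
by Gaussian elimination over the rationals. The irrational number `√(1 - γ)` enters `C ⊗ C` only
affinely once its square is written as `1 - γ`, so `X` dominates `C ⊗ C / 2` if it does so for a
rational lower and a rational upper bound of it.
-/

namespace ChannelDiscrimination

section PosSemidef

variable {n 𝕜 : Type*} [RCLike 𝕜]

lemma posSemidef_map_ofReal [Finite n] {A : Matrix n n ℝ} (hA : A.PosSemidef) :
    (A.map Complex.ofReal).PosSemidef := by
  classical
  have := Fintype.ofFinite n
  open scoped MatrixOrder in
  obtain ⟨B, rfl⟩ := CStarAlgebra.nonneg_iff_eq_star_mul_self.mp hA.nonneg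
  have h : (star B * B).map Complex.ofReal = (B.map Complex.ofReal)ᴴ * B.map Complex.ofReal := by
    ext i j
    simp [Matrix.mul_apply, Matrix.star_eq_conjTranspose]
  exact h ▸ Matrix.posSemidef_conjTranspose_mul_self _

lemma trace_mul_nonneg_of_posSemidef [Fintype n] {A B : Matrix n n 𝕜} (hA : A.PosSemidef)
    (hB : B.PosSemidef) : 0 ≤ (A * B).trace := by
  classical
  open scoped MatrixOrder in
  obtain ⟨C, rfl⟩ := CStarAlgebra.nonneg_iff_eq_star_mul_self.mp hB.nonneg
  rw [← mul_assoc, Matrix.trace_mul_comm, ← mul_assoc]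
  exact (hA.mul_mul_conjTranspose_same C).trace_nonneg

lemma isClosed_posSemidef [Finite n] : IsClosed {A : Matrix n n 𝕜 | A.PosSemidef} := by
  have := Fintype.ofFinite n
  simp only [Matrix.posSemidef_iff_dotProduct_mulVec, Set.ofPred_and, Set.ofPred_forall]
  refine (isClosed_eq (by fun_prop) continuous_id).inter (isClosed_iInter fun x => ?_)
  exact isClosed_le continuous_const (by fun_prop)

lemma norm_apply_le_trace_of_posSemidef [Fintype n] {A : Matrix n n 𝕜} (hA : A.PosSemidef)
    (i j : n) : ‖A i j‖ ≤ RCLike.re A.trace := by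
  classical
  open scoped MatrixOrder in
  obtain ⟨B, rfl⟩ := CStarAlgebra.nonneg_iff_eq_star_mul_self.mp hA.nonneg
  have sq_le_row : ∀ k i, ‖B k i‖ ^ 2 ≤ ∑ l, ‖B k l‖ ^ 2 := fun k i =>
    Finset.single_le_sum (f := fun l => ‖B k l‖ ^ 2) (fun _ _ => by positivity)
      (Finset.mem_univ i)
  have trace_eq : RCLike.re (star B * B).trace = ∑ k, ∑ l, ‖B k l‖ ^ 2 := by
    rw [Finset.sum_comm]
    simp only [Matrix.trace, Matrix.diag, Matrix.mul_apply, Matrix.star_eq_conjTranspose,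
      Matrix.conjTranspose_apply, RCLike.star_def, RCLike.conj_mul, map_sum, RCLike.re_ofReal_pow]
  rw [trace_eq, Matrix.mul_apply]
  refine (norm_sum_le _ _).trans (Finset.sum_le_sum fun k _ => ?_)
  rw [Matrix.star_eq_conjTranspose, Matrix.conjTranspose_apply, norm_mul, norm_star]
  nlinarith [sq_le_row k i, sq_le_row k j, sq_nonneg (‖B k i‖ - ‖B k j‖)]

lemma isCompact_posSemidef_trace_le [Fintype n] (c : ℝ) :
    IsCompact {A : Matrix n n 𝕜 | A.PosSemidef ∧ RCLike.re A.trace ≤ c} := by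
  have hK : IsCompact (Set.univ.pi fun _ : n => Set.univ.pi fun _ : n =>
      Metric.closedBall (0 : 𝕜) c) :=
    isCompact_univ_pi fun _ => isCompact_univ_pi fun _ => isCompact_closedBall 0 c
  have hc : IsClosed {A : Matrix n n 𝕜 | RCLike.re A.trace ≤ c} :=
    isClosed_le (RCLike.continuous_re.comp (by fun_prop)) continuous_const
  refine hK.of_isClosed_subset (isClosed_posSemidef.inter hc) ?_
  rintro A ⟨hA, hc⟩ i - j -
  exact mem_closedBall_zero_iff.mpr ((norm_apply_le_trace_of_posSemidef hA i j).trans hc)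

/-- The Schur complement of the first diagonal entry, multiplied by that entry so that no division
occurs. -/
def schurComplement {n : ℕ} (A : Matrix (Fin (n + 1)) (Fin (n + 1)) ℝ) :
    Matrix (Fin n) (Fin n) ℝ :=
  Matrix.of fun i j => A 0 0 * A i.succ j.succ - A i.succ 0 * A 0 j.succ

/-- Positivity of all pivots in the Gaussian elimination of a matrix without row exchanges. -/
def PivotsPos : ∀ {n : ℕ}, Matrix (Fin n) (Fin n) ℝ → Prop
  | 0, _ => True
  | _ + 1, A => 0 < A 0 0 ∧ PivotsPos (schurComplement A)

lemma dotProduct_mulVec_eq_sq_add_schur {n : ℕ} {A : Matrix (Fin (n + 1)) (Fin (n + 1)) ℝ}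
    (hA : A.IsSymm) (x : Fin (n + 1) → ℝ) :
    A 0 0 * (x ⬝ᵥ A *ᵥ x) = (A 0 0 * x 0 + ∑ j : Fin n, A 0 j.succ * x j.succ) ^ 2 +
      Fin.tail x ⬝ᵥ schurComplement A *ᵥ Fin.tail x := by
  set v : ℝ := ∑ j : Fin n, A 0 j.succ * x j.succ with hv
  have first_column (c : ℝ) : ∑ i : Fin n, x i.succ * (A i.succ 0 * c) = v * c := by
    rw [hv, Finset.sum_mul]
    exact Finset.sum_congr rfl fun i _ => by rw [hA.apply]; ring
  have schur_form : Fin.tail x ⬝ᵥ schurComplement A *ᵥ Fin.tail x =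
      A 0 0 * ∑ i : Fin n, x i.succ * ∑ j : Fin n, A i.succ j.succ * x j.succ - v * v := by
    simp only [dotProduct, Matrix.mulVec, Fin.tail, schurComplement, Matrix.of_apply, sub_mul,
      Finset.sum_sub_distrib, mul_assoc, ← Finset.mul_sum, mul_sub, ← hv, first_column]
    simp only [Finset.mul_sum, mul_left_comm]
  rw [schur_form]
  simp only [dotProduct, Matrix.mulVec, Fin.sum_univ_succ, mul_add, Finset.sum_add_distrib,
    first_column, ← hv]
  ring

lemma PivotsPos.posSemidef {n : ℕ} {A : Matrix (Fin n) (Fin n) ℝ} (h : PivotsPos A)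
    (hA : A.IsSymm) : A.PosSemidef := by
  induction n with
  | zero => exact Subsingleton.elim 0 A ▸ .zero
  | succ n ih =>
    have schur_symm : (schurComplement A).IsSymm := Matrix.IsSymm.ext fun i j => by
      simp only [schurComplement, Matrix.of_apply, hA.apply i.succ j.succ, hA.apply 0 i.succ,
        hA.apply j.succ 0, mul_comm (A 0 i.succ)]
    refine .of_dotProduct_mulVec_nonneg (Matrix.isHermitian_iff_isSymm.mpr hA) fun x => ?_
    have schur_nonneg := (ih h.2 schur_symm).dotProduct_mulVec_nonneg (Fin.tail x)
    refine nonneg_of_mul_nonneg_right ?_ h.1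
    rw [star_trivial, dotProduct_mulVec_eq_sq_add_schur hA]
    exact add_nonneg (sq_nonneg _) schur_nonneg

end PosSemidef

section TraceReplace

/-- Trace-and-replace on the factor `X` of a space decomposed as `X ⊗ Y`. -/
noncomputable def traceReplace {n X Y : Type*} [Fintype X] [DecidableEq X] (e : n ≃ X × Y) :
    Matrix n n ℂ →ₗ[ℂ] Matrix n n ℂ where
  toFun A := Matrix.of fun a b =>
    if (e a).1 = (e b).1 then
      (Fintype.card X : ℂ)⁻¹ * ∑ x : X, A (e.symm (x, (e a).2)) (e.symm (x, (e b).2))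
    else 0
  map_add' A B := by
    ext a b
    by_cases h : (e a).1 = (e b).1 <;> simp [h, Finset.sum_add_distrib, mul_add]
  map_smul' c A := by
    ext a b
    by_cases h : (e a).1 = (e b).1 <;> simp [h, ← Finset.mul_sum, mul_left_comm]

variable {n X Y : Type*} [Fintype X] [DecidableEq X] (e : n ≃ X × Y)

lemma traceReplace_one [DecidableEq n] [Nonempty X] : traceReplace e 1 = 1 := by
  ext a b
  simp only [traceReplace, LinearMap.coe_mk, AddHom.coe_mk, Matrix.of_apply]
  rcases eq_or_ne a b with rfl | hab
  · simp
  rw [Matrix.one_apply_ne hab, ite_eq_right_iff]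
  intro h₁
  have h₂ (x : X) : e.symm (x, (e a).2) ≠ e.symm (x, (e b).2) := fun h =>
    hab (e.injective (Prod.ext h₁ (by simpa using h)))
  simp only [Matrix.one_apply_ne (h₂ _), Finset.sum_const_zero, mul_zero]

lemma trace_traceReplace_mul [Fintype n] [Finite Y] (A B : Matrix n n ℂ) :
    (traceReplace e A * B).trace = (A * traceReplace e B).trace := by
  have := Fintype.ofFinite Y
  have trace_eq (A B : Matrix n n ℂ) : (traceReplace e A * B).trace = (Fintype.card X : ℂ)⁻¹ *
      ∑ y, ∑ y', (∑ x, A (e.symm (x, y)) (e.symm (x, y'))) *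
        ∑ x, B (e.symm (x, y')) (e.symm (x, y)) := by
    simp only [Matrix.trace, Matrix.diag, Matrix.mul_apply, ← e.symm.sum_comp, traceReplace,
      LinearMap.coe_mk, AddHom.coe_mk, Matrix.of_apply, Equiv.apply_symm_apply,
      Fintype.sum_prod_type, ite_mul, zero_mul, Finset.sum_ite_irrel, Finset.sum_const_zero,
      Finset.sum_ite_eq, Finset.mem_univ, if_true, mul_assoc, ← Finset.mul_sum]
    congr 1
    rw [Finset.sum_comm]
    refine Finset.sum_congr rfl fun y _ => ?_
    rw [Finset.sum_comm]
    simp only [← Finset.mul_sum]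
  rw [trace_eq, Matrix.trace_mul_comm, trace_eq, Finset.sum_comm]
  simp only [mul_comm]

variable {I₁ O₁ I₂ O₂ : Type*}

lemma replI₁_eq_traceReplace [Fintype I₁] [DecidableEq I₁] :
    (replI₁ : Op I₁ O₁ I₂ O₂ → Op I₁ O₁ I₂ O₂) = traceReplace (Equiv.prodAssoc I₁ O₁ (I₂ × O₂)) :=
  rfl

lemma replO₁_eq_traceReplace [Fintype O₁] [DecidableEq O₁] :
    (replO₁ : Op I₁ O₁ I₂ O₂ → Op I₁ O₁ I₂ O₂) = traceReplace
      (((Equiv.prodComm I₁ O₁).prodCongr (.refl (I₂ × O₂))).trans (.prodAssoc _ _ _)) :=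
  rfl

lemma replI₂_eq_traceReplace [Fintype I₂] [DecidableEq I₂] :
    (replI₂ : Op I₁ O₁ I₂ O₂ → Op I₁ O₁ I₂ O₂) = traceReplace
      ((Equiv.prodComm (I₁ × O₁) (I₂ × O₂)).trans (.prodAssoc _ _ _)) :=
  rfl

lemma replO₂_eq_traceReplace [Fintype O₂] [DecidableEq O₂] :
    (replO₂ : Op I₁ O₁ I₂ O₂ → Op I₁ O₁ I₂ O₂) = traceReplace
      (((Equiv.prodComm (I₁ × O₁) (I₂ × O₂)).trans
        ((Equiv.prodComm I₂ O₂).prodCongr (.refl _))).trans (.prodAssoc _ _ _)) :=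
  rfl

end TraceReplace

section Repl

variable {I₁ O₁ I₂ O₂ : Type*}

@[fun_prop]
lemma continuous_replI₁ [Finite O₁] [Finite I₂] [Finite O₂] [Fintype I₁] [DecidableEq I₁] :
    Continuous (replI₁ : Op I₁ O₁ I₂ O₂ → Op I₁ O₁ I₂ O₂) := by
  rw [replI₁_eq_traceReplace]
  exact LinearMap.continuous_of_finiteDimensional _

@[fun_prop]
lemma continuous_replO₁ [Finite I₁] [Finite I₂] [Finite O₂] [Fintype O₁] [DecidableEq O₁] :
    Continuous (replO₁ : Op I₁ O₁ I₂ O₂ → Op I₁ O₁ I₂ O₂) := by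
  rw [replO₁_eq_traceReplace]
  exact LinearMap.continuous_of_finiteDimensional _

@[fun_prop]
lemma continuous_replI₂ [Finite I₁] [Finite O₁] [Finite O₂] [Fintype I₂] [DecidableEq I₂] :
    Continuous (replI₂ : Op I₁ O₁ I₂ O₂ → Op I₁ O₁ I₂ O₂) := by
  rw [replI₂_eq_traceReplace]
  exact LinearMap.continuous_of_finiteDimensional _

@[fun_prop]
lemma continuous_replO₂ [Finite I₁] [Finite O₁] [Finite I₂] [Fintype O₂] [DecidableEq O₂] :
    Continuous (replO₂ : Op I₁ O₁ I₂ O₂ → Op I₁ O₁ I₂ O₂) := by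
  rw [replO₂_eq_traceReplace]
  exact LinearMap.continuous_of_finiteDimensional _

lemma trace_replI₁_mul [Fintype I₁] [Fintype O₁] [Fintype I₂] [Fintype O₂] [DecidableEq I₁]
    (A B : Op I₁ O₁ I₂ O₂) : (replI₁ A * B).trace = (A * replI₁ B).trace := by
  simp only [replI₁_eq_traceReplace, trace_traceReplace_mul]

lemma trace_replO₁_mul [Fintype I₁] [Fintype O₁] [Fintype I₂] [Fintype O₂] [DecidableEq O₁]
    (A B : Op I₁ O₁ I₂ O₂) : (replO₁ A * B).trace = (A * replO₁ B).trace := by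
  simp only [replO₁_eq_traceReplace, trace_traceReplace_mul]

lemma trace_replI₂_mul [Fintype I₁] [Fintype O₁] [Fintype I₂] [Fintype O₂] [DecidableEq I₂]
    (A B : Op I₁ O₁ I₂ O₂) : (replI₂ A * B).trace = (A * replI₂ B).trace := by
  simp only [replI₂_eq_traceReplace, trace_traceReplace_mul]

lemma trace_replO₂_mul [Fintype I₁] [Fintype O₁] [Fintype I₂] [Fintype O₂] [DecidableEq O₂]
    (A B : Op I₁ O₁ I₂ O₂) : (replO₂ A * B).trace = (A * replO₂ B).trace := by
  simp only [replO₂_eq_traceReplace, trace_traceReplace_mul]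

variable [DecidableEq I₁] [DecidableEq O₁] [DecidableEq I₂] [DecidableEq O₂]

lemma replI₁_smul_one [Fintype I₁] [Nonempty I₁] (c : ℂ) :
    replI₁ (c • 1 : Op I₁ O₁ I₂ O₂) = c • 1 := by
  rw [replI₁_eq_traceReplace, map_smul, traceReplace_one]

lemma replO₁_smul_one [Fintype O₁] [Nonempty O₁] (c : ℂ) :
    replO₁ (c • 1 : Op I₁ O₁ I₂ O₂) = c • 1 := by
  rw [replO₁_eq_traceReplace, map_smul, traceReplace_one]

lemma replI₂_smul_one [Fintype I₂] [Nonempty I₂] (c : ℂ) :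
    replI₂ (c • 1 : Op I₁ O₁ I₂ O₂) = c • 1 := by
  rw [replI₂_eq_traceReplace, map_smul, traceReplace_one]

lemma replO₂_smul_one [Fintype O₂] [Nonempty O₂] (c : ℂ) :
    replO₂ (c • 1 : Op I₁ O₁ I₂ O₂) = c • 1 := by
  rw [replO₂_eq_traceReplace, map_smul, traceReplace_one]

end Repl

section Existence

variable {I₁ O₁ I₂ O₂ : Type*} [Fintype I₁] [Fintype O₁] [Fintype I₂] [Fintype O₂]

lemma isCompact_isNormalized : IsCompact {W : Op I₁ O₁ I₂ O₂ | IsNormalized W} := by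
  refine (isCompact_posSemidef_trace_le
    ((Fintype.card O₁ : ℂ) * (Fintype.card O₂ : ℂ)).re).of_isClosed_subset
    (isClosed_posSemidef.inter (isClosed_eq (by fun_prop) continuous_const)) ?_
  rintro W ⟨hW, ht⟩
  exact ⟨hW, (congrArg Complex.re ht).le⟩

lemma isCompact_isParallelProcess [DecidableEq O₁] [DecidableEq O₂] :
    IsCompact {W : Op I₁ O₁ I₂ O₂ | IsParallelProcess W} :=
  isCompact_isNormalized.inter_right (isClosed_eq (by fun_prop) (by fun_prop))

lemma isCompact_isSequentialProcess [DecidableEq O₁] [DecidableEq I₂] [DecidableEq O₂] :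
    IsCompact {W : Op I₁ O₁ I₂ O₂ | IsSequentialProcess W} :=
  isCompact_isNormalized.inter_right
    ((isClosed_eq (by fun_prop) (by fun_prop)).inter (isClosed_eq (by fun_prop) (by fun_prop)))

lemma isCompact_isSequentialProcess' [DecidableEq I₁] [DecidableEq O₁] [DecidableEq O₂] :
    IsCompact {W : Op I₁ O₁ I₂ O₂ | IsSequentialProcess' W} :=
  isCompact_isNormalized.inter_right
    ((isClosed_eq (by fun_prop) (by fun_prop)).inter (isClosed_eq (by fun_prop) (by fun_prop)))

variable [DecidableEq I₁] [DecidableEq O₁] [DecidableEq I₂] [DecidableEq O₂]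

lemma isCompact_isGeneralProcess : IsCompact {W : Op I₁ O₁ I₂ O₂ | IsGeneralProcess W} :=
  isCompact_isNormalized.inter_right
    ((isClosed_eq (by fun_prop) (by fun_prop)).inter ((isClosed_eq (by fun_prop)
      (by fun_prop)).inter (isClosed_eq (by fun_prop) (by fun_prop))))

lemma isCompact_isSeparableProcess : IsCompact {W : Op I₁ O₁ I₂ O₂ | IsSeparableProcess W} := by
  have hK := (isCompact_Icc (a := (0 : ℝ)) (b := 1)).prod
    ((isCompact_isSequentialProcess (I₁ := I₁) (O₁ := O₁) (I₂ := I₂) (O₂ := O₂)).prod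
      (isCompact_isSequentialProcess' (I₁ := I₁) (O₁ := O₁) (I₂ := I₂) (O₂ := O₂)))
  have hf : Continuous fun x : ℝ × Op I₁ O₁ I₂ O₂ × Op I₁ O₁ I₂ O₂ =>
      (x.1 : ℂ) • x.2.1 + ((1 - x.1 : ℝ) : ℂ) • x.2.2 := by fun_prop
  convert isCompact_isNormalized.inter_right (hK.image hf).isClosed using 1
  refine Set.ext fun W => and_congr_right fun _ => ⟨?_, ?_⟩
  · rintro ⟨q, W₁₂, W₂₁, h₀, h₁, hW₁₂, hW₂₁, rfl⟩
    exact ⟨(q, W₁₂, W₂₁), ⟨⟨h₀, h₁⟩, hW₁₂, hW₂₁⟩, rfl⟩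
  · rintro ⟨⟨q, W₁₂, W₂₁⟩, ⟨⟨h₀, h₁⟩, hW₁₂, hW₂₁⟩, rfl⟩
    exact ⟨q, W₁₂, W₂₁, h₀, h₁, hW₁₂, hW₂₁, rfl⟩

lemma isCompact_isProcess (S : Strategy) : IsCompact {W : Op I₁ O₁ I₂ O₂ | IsProcess S W} := by
  cases S
  · exact isCompact_isParallelProcess
  · exact isCompact_isSequentialProcess
  · exact isCompact_isSeparableProcess
  · exact isCompact_isGeneralProcess

lemma IsProcess.isNormalized {S : Strategy} {W : Op I₁ O₁ I₂ O₂} (hW : IsProcess S W) :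
    IsNormalized W := by
  cases S <;> exact hW.1

lemma isCompact_isTester {ι : Type*} [Fintype ι] (S : Strategy) :
    IsCompact {T : ι → Op I₁ O₁ I₂ O₂ | IsTester S T} := by
  have hK := isCompact_univ_pi fun _ : ι => isCompact_posSemidef_trace_le
    (n := (I₁ × O₁) × (I₂ × O₂)) (𝕜 := ℂ) ((Fintype.card O₁ : ℂ) * (Fintype.card O₂ : ℂ)).re
  refine hK.of_isClosed_subset ?_ ?_
  · simp only [IsTester, Set.ofPred_and, Set.ofPred_forall]
    refine IsClosed.inter (isClosed_iInter fun i => ?_) ?_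
    · exact isClosed_posSemidef.preimage (f := fun T : ι → Op I₁ O₁ I₂ O₂ => T i)
        (continuous_apply i)
    · exact (isCompact_isProcess S).isClosed.preimage
        (f := fun T : ι → Op I₁ O₁ I₂ O₂ => ∑ i, T i) (by fun_prop)
  · rintro T ⟨hT, hW⟩ i -
    refine ⟨hT i, ?_⟩
    rw [← hW.isNormalized.2, Matrix.trace_sum, Complex.re_sum]
    exact Finset.single_le_sum (f := fun j => (T j).trace.re)
      (fun j _ => (Complex.nonneg_iff.mp (hT j).trace_nonneg).1) (Finset.mem_univ i)

lemma exists_isProcess [Nonempty I₁] [Nonempty O₁] [Nonempty I₂] [Nonempty O₂] (S : Strategy) :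
    ∃ W : Op I₁ O₁ I₂ O₂, IsProcess S W := by
  let c : ℂ := (Fintype.card I₁ : ℂ)⁻¹ * (Fintype.card I₂ : ℂ)⁻¹
  have hW : IsNormalized (c • 1 : Op I₁ O₁ I₂ O₂) := by
    refine ⟨Matrix.PosSemidef.one.smul (by positivity), ?_⟩
    simp only [c, Matrix.trace_smul, Matrix.trace_one, Fintype.card_prod, smul_eq_mul]
    push_cast
    field_simp
  have seq : IsSequentialProcess (c • 1 : Op I₁ O₁ I₂ O₂) := by
    simp [IsSequentialProcess, hW, replO₁_smul_one, replI₂_smul_one, replO₂_smul_one]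
  have seq' : IsSequentialProcess' (c • 1 : Op I₁ O₁ I₂ O₂) := by
    simp [IsSequentialProcess', hW, replI₁_smul_one, replO₁_smul_one, replO₂_smul_one]
  refine ⟨c • 1, ?_⟩
  cases S
  · simp [IsProcess, IsParallelProcess, hW, replO₁_smul_one, replO₂_smul_one]
  · exact seq
  · exact ⟨hW, 1, _, _, zero_le_one, le_rfl, seq, seq', by simp⟩
  · simp [IsProcess, IsGeneralProcess, hW, replI₁_smul_one, replO₁_smul_one, replI₂_smul_one,
      replO₂_smul_one]

lemma IsProcess.exists_isTester {ι : Type*} [Fintype ι] [Nonempty ι] {S : Strategy}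
    {W : Op I₁ O₁ I₂ O₂} (hW : IsProcess S W) : ∃ T : ι → Op I₁ O₁ I₂ O₂, IsTester S T := by
  classical
  obtain ⟨i₀⟩ := ‹Nonempty ι›
  refine ⟨Pi.single i₀ W, fun i => ?_, ?_⟩
  · rcases eq_or_ne i i₀ with rfl | h
    · simpa using hW.isNormalized.1
    · simpa [h] using Matrix.PosSemidef.zero
  · simpa using hW

lemma isGreatest_maxSuccess {ι I O : Type*} [Fintype ι] [Nonempty ι] [Fintype I] [Nonempty I]
    [Fintype O] [Nonempty O] [DecidableEq I] [DecidableEq O] (S : Strategy) (p : ι → ℝ)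
    (Φ : ι → Matrix I I ℂ →ₗ[ℂ] Matrix O O ℂ) :
    IsGreatest (successProbabilities S p Φ) (maxSuccess S p Φ) := by
  have hc : Continuous (successProbability p Φ) := by
    unfold successProbability
    exact continuous_finsetSum _ fun i _ => continuous_const.mul
      (Complex.continuous_re.comp (by fun_prop))
  have image_eq : successProbability p Φ '' {T | IsTester S T} = successProbabilities S p Φ :=
    Set.ext fun r => exists_congr fun T => and_congr_right fun _ => eq_comm
  obtain ⟨W, hW⟩ := exists_isProcess (I₁ := I) (O₁ := O) (I₂ := I) (O₂ := O) S
  exact (image_eq ▸ (isCompact_isTester S).image hc).isGreatest_sSup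
    (image_eq ▸ Set.Nonempty.image _ hW.exists_isTester)

end Existence

section SwapSlots

variable {I₁ O₁ I₂ O₂ : Type*}

/-- The operator on `I₂ ⊗ O₂ ⊗ I₁ ⊗ O₁` obtained by exchanging the roles of the two slots. -/
def swapSlots (A : Op I₁ O₁ I₂ O₂) : Op I₂ O₂ I₁ O₁ :=
  A.submatrix Prod.swap Prod.swap

variable [Fintype I₁] [Fintype O₁] [Fintype I₂] [Fintype O₂]

lemma trace_swapSlots (A : Op I₁ O₁ I₂ O₂) : (swapSlots A).trace = A.trace :=
  (Equiv.prodComm _ _).sum_comp fun a => A a a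

lemma swapSlots_mul (A B : Op I₁ O₁ I₂ O₂) :
    swapSlots (A * B) = swapSlots A * swapSlots B :=
  (Matrix.submatrix_mul_equiv A B _ (Equiv.prodComm _ _) _).symm

lemma isNormalized_swapSlots {W : Op I₁ O₁ I₂ O₂} :
    IsNormalized (swapSlots W) ↔ IsNormalized W := by
  rw [IsNormalized, IsNormalized, trace_swapSlots, mul_comm (Fintype.card O₁ : ℂ)]
  exact and_congr_left' (Matrix.posSemidef_submatrix_equiv (Equiv.prodComm _ _))

lemma isSequentialProcess_swapSlots [DecidableEq I₁] [DecidableEq O₁] [DecidableEq O₂]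
    {W : Op I₁ O₁ I₂ O₂} : IsSequentialProcess (swapSlots W) ↔ IsSequentialProcess' W := by
  have swap_inj (A B : Op I₁ O₁ I₂ O₂) : swapSlots A = swapSlots B ↔ A = B :=
    (Matrix.reindex (Equiv.prodComm _ _) (Equiv.prodComm _ _)).apply_eq_iff_eq
  exact and_congr isNormalized_swapSlots <| and_congr (swap_inj W (replO₁ W))
    (swap_inj (replI₁ (replO₁ W)) (replO₂ (replI₁ (replO₁ W))))

end SwapSlots

section Duality

variable {I₁ O₁ I₂ O₂ : Type*} [Fintype I₁] [Fintype O₁] [Fintype I₂] [Fintype O₂]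
  [DecidableEq I₁] [DecidableEq O₁] [DecidableEq I₂] [DecidableEq O₂]

lemma IsNormalized.trace_mul_smul_one {W : Op I₁ O₁ I₂ O₂} (hW : IsNormalized W) (c : ℂ) :
    (W * (c • 1)).trace = c * ((Fintype.card O₁ : ℂ) * (Fintype.card O₂ : ℂ)) := by
  rw [Matrix.mul_smul, mul_one, Matrix.trace_smul, hW.2, smul_eq_mul]

/-- The adjoint of the projection onto the linear span of the parallel processes. -/
noncomputable def parallelProjection (X : Op I₁ O₁ I₂ O₂) : Op I₁ O₁ I₂ O₂ :=
  replO₂ (replO₁ X)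

/-- The adjoint of a projection onto the linear span of the sequential processes. -/
noncomputable def sequentialProjection (X : Op I₁ O₁ I₂ O₂) : Op I₁ O₁ I₂ O₂ :=
  replO₂ X - replO₂ (replI₂ X) + replO₂ (replI₂ (replO₁ X))

/-- The adjoint of a projection onto the linear span of the general processes. -/
noncomputable def generalProjection (X : Op I₁ O₁ I₂ O₂) : Op I₁ O₁ I₂ O₂ :=
  replO₁ X + replO₂ X - replO₂ (replO₁ X) -
    (replO₁ (replI₁ X) - replO₂ (replO₁ (replI₁ X))) -
    (replO₂ (replI₂ X) - replO₂ (replI₂ (replO₁ X)))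

lemma IsParallelProcess.trace_mul {W X : Op I₁ O₁ I₂ O₂} (hW : IsParallelProcess W) {c : ℂ}
    (hX : parallelProjection X = c • 1) :
    (W * X).trace = c * ((Fintype.card O₁ : ℂ) * (Fintype.card O₂ : ℂ)) := by
  rw [← hW.1.trace_mul_smul_one, ← hX, hW.2, trace_replO₁_mul, trace_replO₂_mul, ← hW.2,
    parallelProjection]

lemma IsSequentialProcess.trace_mul {W X : Op I₁ O₁ I₂ O₂} (hW : IsSequentialProcess W) {c : ℂ}
    (hX : sequentialProjection X = c • 1) :
    (W * X).trace = c * ((Fintype.card O₁ : ℂ) * (Fintype.card O₂ : ℂ)) := by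
  have fixed : W = replO₂ W - replI₂ (replO₂ W) + replO₁ (replI₂ (replO₂ W)) := by
    rw [← hW.2.2, sub_add_cancel, ← hW.2.1]
  rw [← hW.1.trace_mul_smul_one, ← hX]
  conv_lhs => rw [fixed]
  simp only [sequentialProjection, Matrix.add_mul, Matrix.sub_mul, Matrix.mul_add, Matrix.mul_sub,
    Matrix.trace_add, Matrix.trace_sub, trace_replO₁_mul, trace_replO₂_mul, trace_replI₂_mul]

lemma IsGeneralProcess.trace_mul {W X : Op I₁ O₁ I₂ O₂} (hW : IsGeneralProcess W) {c : ℂ}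
    (hX : generalProjection X = c • 1) :
    (W * X).trace = c * ((Fintype.card O₁ : ℂ) * (Fintype.card O₂ : ℂ)) := by
  have fixed : W = replO₁ W + replO₂ W - replO₁ (replO₂ W) -
      (replI₁ (replO₁ W) - replI₁ (replO₁ (replO₂ W))) -
      (replI₂ (replO₂ W) - replO₁ (replI₂ (replO₂ W))) := by
    rw [← hW.2.1, ← hW.2.2.1, sub_self, sub_self, sub_zero, sub_zero, ← hW.2.2.2]
  rw [← hW.1.trace_mul_smul_one, ← hX]
  conv_lhs => rw [fixed]
  simp only [generalProjection, Matrix.add_mul, Matrix.sub_mul, Matrix.mul_add, Matrix.mul_sub,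
    Matrix.trace_add, Matrix.trace_sub, trace_replO₁_mul, trace_replO₂_mul, trace_replI₁_mul,
    trace_replI₂_mul]

end Duality

section SeparableProcess

variable {I O : Type*} [Fintype I] [Fintype O] [DecidableEq I] [DecidableEq O]

lemma IsSeparableProcess.trace_mul_re_le {W X : Op I O I O} (hW : IsSeparableProcess W)
    (hX : swapSlots X = X) {c : ℝ}
    (hc : ∀ V : Op I O I O, IsSequentialProcess V → (V * X).trace.re ≤ c) :
    (W * X).trace.re ≤ c := by
  obtain ⟨-, q, W₁₂, W₂₁, h₀, h₁, hW₁₂, hW₂₁, rfl⟩ := hW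
  have le₁₂ : (W₁₂ * X).trace.re ≤ c := hc W₁₂ hW₁₂
  have le₂₁ : (W₂₁ * X).trace.re ≤ c := by
    have := hc _ (isSequentialProcess_swapSlots.mpr hW₂₁)
    rwa [← hX, ← swapSlots_mul, trace_swapSlots] at this
  rw [Matrix.add_mul, Matrix.trace_add, Complex.add_re, Matrix.smul_mul, Matrix.smul_mul,
    Matrix.trace_smul, Matrix.trace_smul, smul_eq_mul, smul_eq_mul, Complex.re_ofReal_mul,
    Complex.re_ofReal_mul]
  nlinarith

lemma IsSequentialProcess.isSeparableProcess_symmetrize {W : Op I O I O}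
    (hW : IsSequentialProcess W) : IsSeparableProcess ((1 / 2 : ℂ) • (W + swapSlots W)) := by
  have hW' : IsSequentialProcess' (swapSlots W) := isSequentialProcess_swapSlots.mp hW
  refine ⟨⟨(hW.1.1.add hW'.1.1).smul (by positivity), ?_⟩, 1 / 2, W, swapSlots W, by norm_num,
    by norm_num, hW, hW', ?_⟩
  · rw [Matrix.trace_smul, Matrix.trace_add, trace_swapSlots, hW.1.2, smul_eq_mul]
    ring
  · rw [smul_add]
    norm_num

end SeparableProcess

section MaxSuccess

variable {ι I O : Type*} [Fintype ι] [Nonempty ι] [Fintype I] [Nonempty I] [Fintype O] [Nonempty O]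
  [DecidableEq I] [DecidableEq O] {S : Strategy} {p : ι → ℝ}
  {Φ : ι → Matrix I I ℂ →ₗ[ℂ] Matrix O O ℂ}

lemma IsTester.successProbability_le_maxSuccess {T : ι → Op I O I O} (hT : IsTester S T) :
    successProbability p Φ T ≤ maxSuccess S p Φ :=
  (isGreatest_maxSuccess S p Φ).2 ⟨T, hT, rfl⟩

lemma maxSuccess_le_of_dual {X : Op I O I O}
    (hX : ∀ i, (X - (p i : ℂ) • (choi (Φ i) ⊗ₖ choi (Φ i))).PosSemidef) {c : ℝ}
    (hc : ∀ W, IsProcess S W → (W * X).trace.re ≤ c) : maxSuccess S p Φ ≤ c := by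
  obtain ⟨T, ⟨hT, hW⟩, h⟩ := (isGreatest_maxSuccess S p Φ).1
  rw [h]
  refine le_trans ?_ (hc _ hW)
  rw [Finset.sum_mul, Matrix.trace_sum, Complex.re_sum]
  refine Finset.sum_le_sum fun i _ => sub_nonneg.mp ?_
  have gap_nonneg := (Complex.nonneg_iff.mp (trace_mul_nonneg_of_posSemidef (hT i) (hX i))).1
  rwa [Matrix.mul_sub, Matrix.trace_sub, Complex.sub_re, Matrix.mul_smul, Matrix.trace_smul,
    smul_eq_mul, Complex.re_ofReal_mul] at gap_nonneg

end MaxSuccess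

section InvariantOp

/-- The positions of the free entries of a real symmetric operator on two pairs of qubits that is
invariant under `diag(1, e^{-iθ}) ⊗ diag(1, e^{iθ})` on each slot: the diagonal entries, the
coherences `|00⟩⟨11|` of one slot for a fixed basis state `|i o⟩` of the other one, and the
coherences `|00,00⟩⟨11,11|` and `|00,11⟩⟨11,00|` of both slots. -/
inductive Entry
  | diag (i₁ o₁ i₂ o₂ : Fin 2)
  | coh₁ (i₂ o₂ : Fin 2)
  | coh₂ (i₁ o₁ : Fin 2)
  | aligned
  | opposed

/-- A real symmetric operator invariant under the phase rotations of each slot, given by its free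
entries. -/
abbrev InvariantOp : Type := Entry → ℝ

/-- The free entry in a given row and column, if there is one. -/
def entryAt (a b : (Fin 2 × Fin 2) × (Fin 2 × Fin 2)) : Option Entry :=
  if a.1 = b.1 then
    if a.2 = b.2 then some (.diag a.1.1 a.1.2 a.2.1 a.2.2)
    else if a.2.1 = a.2.2 ∧ b.2.1 = b.2.2 then some (.coh₂ a.1.1 a.1.2) else none
  else if a.1.1 = a.1.2 ∧ b.1.1 = b.1.2 then
    if a.2 = b.2 then some (.coh₁ a.2.1 a.2.2)
    else if a.2.1 = a.2.2 ∧ b.2.1 = b.2.2 then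
      some (if a.1.1 = a.2.1 then .aligned else .opposed)
    else none
  else none

lemma entryAt_comm (a b : (Fin 2 × Fin 2) × (Fin 2 × Fin 2)) : entryAt a b = entryAt b a := by
  obtain ⟨⟨i₁, o₁⟩, i₂, o₂⟩ := a
  obtain ⟨⟨i₁', o₁'⟩, i₂', o₂'⟩ := b
  simp only [entryAt, Prod.mk.injEq]
  revert i₁ o₁ i₂ o₂ i₁' o₁' i₂' o₂'
  simp [Fin.forall_fin_two]

/-- The matrix with the given free entries. -/
def toReal : InvariantOp →ₗ[ℝ]
    Matrix ((Fin 2 × Fin 2) × (Fin 2 × Fin 2)) ((Fin 2 × Fin 2) × (Fin 2 × Fin 2)) ℝ where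
  toFun X := Matrix.of fun a b => (entryAt a b).elim 0 X
  map_add' X Y := by
    ext a b
    simp only [Matrix.of_apply, Matrix.add_apply]
    cases entryAt a b <;> simp
  map_smul' r X := by
    ext a b
    simp only [Matrix.of_apply, Matrix.smul_apply]
    cases entryAt a b <;> simp

lemma toReal_apply (X : InvariantOp) (a b : (Fin 2 × Fin 2) × (Fin 2 × Fin 2)) :
    toReal X a b = (entryAt a b).elim 0 X :=
  rfl

/-- The operator on `I₁ ⊗ O₁ ⊗ I₂ ⊗ O₂` with the given free entries. -/
noncomputable def toOp : InvariantOp →ₗ[ℝ] Op (Fin 2) (Fin 2) (Fin 2) (Fin 2) :=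
  (Algebra.linearMap ℝ ℂ).mapMatrix ∘ₗ toReal

lemma toOp_apply (X : InvariantOp) (a b : (Fin 2 × Fin 2) × (Fin 2 × Fin 2)) :
    toOp X a b = (toReal X a b : ℂ) :=
  rfl

/-- The free entries of the identity. -/
def InvariantOp.identity : InvariantOp
  | .diag _ _ _ _ => 1
  | _ => 0

lemma toOp_identity : toOp .identity = 1 := by
  ext ⟨⟨i₁, o₁⟩, i₂, o₂⟩ ⟨⟨i₁', o₁'⟩, i₂', o₂'⟩
  simp only [toOp_apply, toReal_apply, entryAt, Matrix.one_apply, Prod.mk.injEq]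
  revert i₁ o₁ i₂ o₂ i₁' o₁' i₂' o₂'
  simp [Fin.forall_fin_two, InvariantOp.identity]

lemma toOp_smul_identity (c : ℝ) : toOp (c • .identity) = (c : ℂ) • 1 := by
  rw [map_smul, toOp_identity, Complex.coe_smul]

/-- The free entries after exchanging the two slots. -/
def InvariantOp.swap (X : InvariantOp) : InvariantOp
  | .diag i₁ o₁ i₂ o₂ => X (.diag i₂ o₂ i₁ o₁)
  | .coh₁ i o => X (.coh₂ i o)
  | .coh₂ i o => X (.coh₁ i o)
  | .aligned => X .aligned
  | .opposed => X .opposed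

/-- The free entries after tracing out and replacing `I₁`. -/
noncomputable def InvariantOp.replI₁ (X : InvariantOp) : InvariantOp
  | .diag _ o₁ i₂ o₂ => (X (.diag 0 o₁ i₂ o₂) + X (.diag 1 o₁ i₂ o₂)) / 2
  | .coh₂ _ o₁ => (X (.coh₂ 0 o₁) + X (.coh₂ 1 o₁)) / 2
  | _ => 0

/-- The free entries after tracing out and replacing `O₁`. -/
noncomputable def InvariantOp.replO₁ (X : InvariantOp) : InvariantOp
  | .diag i₁ _ i₂ o₂ => (X (.diag i₁ 0 i₂ o₂) + X (.diag i₁ 1 i₂ o₂)) / 2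
  | .coh₂ i₁ _ => (X (.coh₂ i₁ 0) + X (.coh₂ i₁ 1)) / 2
  | _ => 0

/-- The free entries after tracing out and replacing `I₂`. -/
noncomputable def InvariantOp.replI₂ (X : InvariantOp) : InvariantOp :=
  X.swap.replI₁.swap

/-- The free entries after tracing out and replacing `O₂`. -/
noncomputable def InvariantOp.replO₂ (X : InvariantOp) : InvariantOp :=
  X.swap.replO₁.swap

lemma swapSlots_toOp (X : InvariantOp) : swapSlots (toOp X) = toOp X.swap := by
  ext ⟨⟨i₁, o₁⟩, i₂, o₂⟩ ⟨⟨i₁', o₁'⟩, i₂', o₂'⟩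
  simp only [swapSlots, Matrix.submatrix_apply, toOp_apply, toReal_apply, entryAt,
    Prod.swap, Prod.mk.injEq]
  revert i₁ o₁ i₂ o₂ i₁' o₁' i₂' o₂'
  simp [Fin.forall_fin_two, InvariantOp.swap]

lemma replI₁_toOp (X : InvariantOp) : replI₁ (toOp X) = toOp X.replI₁ := by
  ext ⟨⟨i₁, o₁⟩, i₂, o₂⟩ ⟨⟨i₁', o₁'⟩, i₂', o₂'⟩
  simp only [replI₁, Matrix.of_apply, toOp_apply, toReal_apply, entryAt, Prod.mk.injEq,
    Fin.sum_univ_two, Fintype.card_fin]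
  revert i₁ o₁ i₂ o₂ i₁' o₁' i₂' o₂'
  simp [Fin.forall_fin_two, inv_mul_eq_div, InvariantOp.replI₁]

lemma replO₁_toOp (X : InvariantOp) : replO₁ (toOp X) = toOp X.replO₁ := by
  ext ⟨⟨i₁, o₁⟩, i₂, o₂⟩ ⟨⟨i₁', o₁'⟩, i₂', o₂'⟩
  simp only [replO₁, Matrix.of_apply, toOp_apply, toReal_apply, entryAt, Prod.mk.injEq,
    Fin.sum_univ_two, Fintype.card_fin]
  revert i₁ o₁ i₂ o₂ i₁' o₁' i₂' o₂'
  simp [Fin.forall_fin_two, inv_mul_eq_div, InvariantOp.replO₁]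

lemma replI₂_toOp (X : InvariantOp) : replI₂ (toOp X) = toOp X.replI₂ := by
  rw [InvariantOp.replI₂, ← swapSlots_toOp, ← replI₁_toOp, ← swapSlots_toOp]
  rfl

lemma replO₂_toOp (X : InvariantOp) : replO₂ (toOp X) = toOp X.replO₂ := by
  rw [InvariantOp.replO₂, ← swapSlots_toOp, ← replO₁_toOp, ← swapSlots_toOp]
  rfl

/-- The compression of an invariant operator to the span of `|00,00⟩`, `|00,11⟩`, `|11,00⟩` and
`|11,11⟩`. -/
def InvariantOp.centralBlock (X : InvariantOp) : Matrix (Fin 4) (Fin 4) ℝ :=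
  !![X (.diag 0 0 0 0), X (.coh₂ 0 0), X (.coh₁ 0 0), X .aligned;
    X (.coh₂ 0 0), X (.diag 0 0 1 1), X .opposed, X (.coh₁ 1 1);
    X (.coh₁ 0 0), X .opposed, X (.diag 1 1 0 0), X (.coh₂ 1 1);
    X .aligned, X (.coh₁ 1 1), X (.coh₂ 1 1), X (.diag 1 1 1 1)]

/-- The compression of an invariant operator to the span of `|00,io⟩` and `|11,io⟩`. -/
def InvariantOp.pairBlock (X : InvariantOp) (i o : Fin 2) : Matrix (Fin 2) (Fin 2) ℝ :=
  !![X (.diag 0 0 i o), X (.coh₁ i o); X (.coh₁ i o), X (.diag 1 1 i o)]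

/-- Positive definiteness of an invariant operator, block by block. -/
def InvariantOp.BlocksPos (X : InvariantOp) : Prop :=
  PivotsPos X.centralBlock ∧ ∀ i o, i ≠ o → PivotsPos (X.pairBlock i o) ∧
    PivotsPos (X.swap.pairBlock i o) ∧ ∀ k l, k ≠ l → 0 < X (.diag i o k l)

lemma dotProduct_toReal_mulVec (X : InvariantOp) (z : (Fin 2 × Fin 2) × (Fin 2 × Fin 2) → ℝ) :
    z ⬝ᵥ toReal X *ᵥ z =
      ![z ((0, 0), 0, 0), z ((0, 0), 1, 1), z ((1, 1), 0, 0), z ((1, 1), 1, 1)] ⬝ᵥ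
        X.centralBlock *ᵥ
          ![z ((0, 0), 0, 0), z ((0, 0), 1, 1), z ((1, 1), 0, 0), z ((1, 1), 1, 1)] +
      ∑ i : Fin 2,
        (![z ((0, 0), i, 1 - i), z ((1, 1), i, 1 - i)] ⬝ᵥ
          X.pairBlock i (1 - i) *ᵥ ![z ((0, 0), i, 1 - i), z ((1, 1), i, 1 - i)] +
        ![z ((i, 1 - i), 0, 0), z ((i, 1 - i), 1, 1)] ⬝ᵥ
          X.swap.pairBlock i (1 - i) *ᵥ ![z ((i, 1 - i), 0, 0), z ((i, 1 - i), 1, 1)] +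
        ∑ k : Fin 2, X (.diag i (1 - i) k (1 - k)) * z ((i, 1 - i), k, 1 - k) ^ 2) := by
  simp [dotProduct, Matrix.mulVec, Fintype.sum_prod_type, toReal_apply, entryAt, Fin.sum_univ_succ,
    InvariantOp.centralBlock, InvariantOp.pairBlock, InvariantOp.swap]
  ring

lemma InvariantOp.BlocksPos.posSemidef_toOp {X : InvariantOp} (hX : X.BlocksPos) :
    (toOp X).PosSemidef := by
  have central_symm : X.centralBlock.IsSymm := by
    simp [Matrix.IsSymm.ext_iff, InvariantOp.centralBlock, Fin.forall_fin_succ]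
  have pair_symm (Y : InvariantOp) (i o : Fin 2) : (Y.pairBlock i o).IsSymm := by
    simp [Matrix.IsSymm.ext_iff, InvariantOp.pairBlock, Fin.forall_fin_succ]
  have toReal_symm : (toReal X).IsSymm := Matrix.IsSymm.ext fun a b => by
    rw [toReal_apply, toReal_apply, entryAt_comm]
  have ne_sub (i : Fin 2) : i ≠ 1 - i := by decide +revert
  suffices (toReal X).PosSemidef from posSemidef_map_ofReal this
  refine .of_dotProduct_mulVec_nonneg (Matrix.isHermitian_iff_isSymm.mpr toReal_symm) fun z => ?_
  rw [star_trivial, dotProduct_toReal_mulVec]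
  refine add_nonneg ((hX.1.posSemidef central_symm).dotProduct_mulVec_nonneg _)
    (Finset.sum_nonneg fun i _ => ?_)
  obtain ⟨pair, swap_pair, single⟩ := hX.2 i _ (ne_sub i)
  exact add_nonneg (add_nonneg ((pair.posSemidef (pair_symm _ _ _)).dotProduct_mulVec_nonneg _)
    ((swap_pair.posSemidef (pair_symm _ _ _)).dotProduct_mulVec_nonneg _))
    (Finset.sum_nonneg fun k _ => mul_nonneg (single k _ (ne_sub k)).le (sq_nonneg _))

lemma trace_toOp (X : InvariantOp) :
    (toOp X).trace = ((∑ i₁, ∑ o₁, ∑ i₂, ∑ o₂, X (.diag i₁ o₁ i₂ o₂) : ℝ) : ℂ) := by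
  simp [Matrix.trace, Fintype.sum_prod_type, toOp_apply, toReal_apply, entryAt]

/-- The trace of the product of two invariant operators, in terms of their free entries. -/
def InvariantOp.pairing (X Y : InvariantOp) : ℝ :=
  ∑ i₁, ∑ o₁, ∑ i₂, ∑ o₂, X (.diag i₁ o₁ i₂ o₂) * Y (.diag i₁ o₁ i₂ o₂) +
    2 * (∑ i, ∑ o, (X (.coh₁ i o) * Y (.coh₁ i o) + X (.coh₂ i o) * Y (.coh₂ i o)) +
      X .aligned * Y .aligned + X .opposed * Y .opposed)

lemma trace_toOp_mul_toOp (X Y : InvariantOp) :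
    (toOp X * toOp Y).trace.re = X.pairing Y := by
  have entrywise (a b) : toReal X a b * toReal Y b a = toReal (X * Y) a b := by
    rw [toReal_apply, toReal_apply, toReal_apply, entryAt_comm b a]
    cases entryAt a b <;> simp
  have trace_eq : (toOp X * toOp Y).trace.re = ∑ a, ∑ b, toReal (X * Y) a b := by
    simp [Matrix.trace, Matrix.mul_apply, toOp_apply, entrywise]
  rw [trace_eq]
  simp [Fintype.sum_prod_type, toReal_apply, entryAt, InvariantOp.pairing]
  ring

end InvariantOp

section Damping

/-- The probability that an amplitude-damping channel sends `|i⟩` to `|o⟩`. -/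
def dampingProb (γ : ℝ) : Matrix (Fin 2) (Fin 2) ℝ :=
  !![1, 0; γ, 1 - γ]

/-- The free entries of `C ⊗ C` for an amplitude-damping channel that multiplies the coherence
`|0⟩⟨1|` by `s`. The dependence on `s` is kept affine by writing `1 - γ` for `s ^ 2`. -/
def dampingOp (γ s : ℝ) : InvariantOp
  | .diag i₁ o₁ i₂ o₂ => dampingProb γ i₁ o₁ * dampingProb γ i₂ o₂
  | .coh₁ i o => s * dampingProb γ i o
  | .coh₂ i o => s * dampingProb γ i o
  | .aligned => 1 - γ
  | .opposed => 1 - γ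

lemma choi_amplitudeDamping_apply {γ : ℝ} (h₀ : 0 ≤ γ) (h₁ : γ ≤ 1) (a b : Fin 2 × Fin 2) :
    choi (amplitudeDamping γ) a b =
      ((if a = b then dampingProb γ a.1 a.2
        else if a.1 = a.2 ∧ b.1 = b.2 then √(1 - γ) else 0 : ℝ) : ℂ) := by
  have sq_sqrt : ((√(1 - γ) : ℝ) : ℂ) * (√(1 - γ) : ℝ) = 1 - γ := by
    rw [← Complex.ofReal_mul, Real.mul_self_sqrt (by linarith), Complex.ofReal_sub,
      Complex.ofReal_one]
  have sq_sqrt' : ((√γ : ℝ) : ℂ) * (√γ : ℝ) = γ := by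
    rw [← Complex.ofReal_mul, Real.mul_self_sqrt h₀]
  obtain ⟨i, o⟩ := a
  obtain ⟨i', o'⟩ := b
  simp only [choi, amplitudeDamping, krausMap, LinearMap.coe_mk, AddHom.coe_mk, Matrix.of_apply,
    Prod.mk.injEq]
  revert i o i' o'
  simp [Fin.forall_fin_two, dampingProb, Matrix.vecMul, dotProduct, sq_sqrt, sq_sqrt']

lemma choi_kronecker_choi {γ : ℝ} (h₀ : 0 ≤ γ) (h₁ : γ ≤ 1) :
    choi (amplitudeDamping γ) ⊗ₖ choi (amplitudeDamping γ) = toOp (dampingOp γ √(1 - γ)) := by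
  have sq_sqrt : √(1 - γ) * √(1 - γ) = 1 - γ := Real.mul_self_sqrt (by linarith)
  ext ⟨⟨i₁, o₁⟩, i₂, o₂⟩ ⟨⟨i₁', o₁'⟩, i₂', o₂'⟩
  rw [Matrix.kroneckerMap_apply, choi_amplitudeDamping_apply h₀ h₁,
    choi_amplitudeDamping_apply h₀ h₁, toOp_apply, ← Complex.ofReal_mul, toReal_apply]
  congr 1
  simp only [entryAt, Prod.mk.injEq]
  revert i₁ o₁ i₂ o₂ i₁' o₁' i₂' o₂'
  simp [Fin.forall_fin_two, dampingOp, dampingProb, sq_sqrt, mul_comm √(1 - γ)]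

lemma posSemidef_toOp_sub_smul_dampingOp {X : InvariantOp} {γ r a b s : ℝ}
    (ha : (toOp (X - r • dampingOp γ a)).PosSemidef)
    (hb : (toOp (X - r • dampingOp γ b)).PosSemidef) (hs : s ∈ Set.Icc a b) :
    (toOp (X - r • dampingOp γ s)).PosSemidef := by
  obtain ⟨u, v, hu, hv, huv, rfl⟩ := Icc_subset_segment hs
  have affine : X - r • dampingOp γ (u • a + v • b) =
      u • (X - r • dampingOp γ a) + v • (X - r • dampingOp γ b) := by
    obtain rfl : v = 1 - u := by linarith
    funext e
    cases e <;> simp [dampingOp] <;> ring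
  rw [affine, map_add, map_smul, map_smul]
  exact (ha.smul hu).add (hb.smul hv)

lemma choi_kronecker_choi_twoDampings_zero : choi (twoDampings 0) ⊗ₖ choi (twoDampings 0) =
    toOp (dampingOp (37 / 100) √(1 - 37 / 100)) :=
  choi_kronecker_choi (by norm_num) (by norm_num)

lemma choi_kronecker_choi_twoDampings_one : choi (twoDampings 1) ⊗ₖ choi (twoDampings 1) =
    toOp (dampingOp (87 / 100) √(1 - 87 / 100)) :=
  choi_kronecker_choi (by norm_num) (by norm_num)

lemma sqrt_one_sub_decay₁_mem_Icc : √(1 - 37 / 100) ∈ Set.Icc (0.7937253 : ℝ) 0.7937254 :=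
  ⟨Real.le_sqrt_of_sq_le (by norm_num), Real.sqrt_le_iff.mpr (by norm_num)⟩

lemma sqrt_one_sub_decay₂_mem_Icc : √(1 - 87 / 100) ∈ Set.Icc (0.3605551 : ℝ) 0.3605552 :=
  ⟨Real.le_sqrt_of_sq_le (by norm_num), Real.sqrt_le_iff.mpr (by norm_num)⟩

/-- A certificate for upper bounds: an invariant operator that dominates `C₁ ⊗ C₁ / 2` and
`C₂ ⊗ C₂ / 2`, checked for rational bounds of `√(1 - γ₁)` and `√(1 - γ₂)`. -/
structure IsDualFeasible (X : InvariantOp) : Prop where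
  lower₁ : (X - (1 / 2 : ℝ) • dampingOp (37 / 100) 0.7937253).BlocksPos
  upper₁ : (X - (1 / 2 : ℝ) • dampingOp (37 / 100) 0.7937254).BlocksPos
  lower₂ : (X - (1 / 2 : ℝ) • dampingOp (87 / 100) 0.3605551).BlocksPos
  upper₂ : (X - (1 / 2 : ℝ) • dampingOp (87 / 100) 0.3605552).BlocksPos

lemma IsDualFeasible.P_le {X : InvariantOp} (hX : IsDualFeasible X) {S : Strategy} {c : ℝ}
    (hc : ∀ W, IsProcess S W → (W * toOp X).trace.re ≤ c) : P S ≤ c := by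
  refine maxSuccess_le_of_dual (X := toOp X) (Fin.forall_fin_two.mpr ⟨?_, ?_⟩) hc
  · rw [choi_kronecker_choi_twoDampings_zero, Complex.coe_smul, ← map_smul, ← map_sub]
    exact posSemidef_toOp_sub_smul_dampingOp hX.lower₁.posSemidef_toOp hX.upper₁.posSemidef_toOp
      sqrt_one_sub_decay₁_mem_Icc
  · rw [choi_kronecker_choi_twoDampings_one, Complex.coe_smul, ← map_smul, ← map_sub]
    exact posSemidef_toOp_sub_smul_dampingOp hX.lower₂.posSemidef_toOp hX.upper₂.posSemidef_toOp
      sqrt_one_sub_decay₂_mem_Icc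

lemma lt_P_of_isProcess {S : Strategy} {T W : InvariantOp} (hW : IsProcess S (toOp W))
    (hT : T.BlocksPos) (hWT : (W - T).BlocksPos) {c : ℝ}
    (hc : ∀ s₁ ∈ Set.Icc 0.7937253 0.7937254, ∀ s₂ ∈ Set.Icc 0.3605551 0.3605552,
      c < 1 / 2 * T.pairing (dampingOp (37 / 100) s₁) +
        1 / 2 * (W - T).pairing (dampingOp (87 / 100) s₂)) : c < P S := by
  have isTester : IsTester S ![toOp T, toOp (W - T)] := by
    refine ⟨Fin.forall_fin_two.mpr ⟨hT.posSemidef_toOp, hWT.posSemidef_toOp⟩, ?_⟩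
    simpa using hW
  refine (hc _ sqrt_one_sub_decay₁_mem_Icc _ sqrt_one_sub_decay₂_mem_Icc).trans_le
    (le_of_eq_of_le ?_ isTester.successProbability_le_maxSuccess)
  simp only [successProbability, Fin.sum_univ_two, Matrix.cons_val_zero, Matrix.cons_val_one,
    choi_kronecker_choi_twoDampings_zero, choi_kronecker_choi_twoDampings_one, trace_toOp_mul_toOp]

end Damping

section Certificates

lemma Entry.forall_iff {p : Entry → Prop} : (∀ e, p e) ↔
    (∀ i₁ o₁ i₂ o₂, p (.diag i₁ o₁ i₂ o₂)) ∧ (∀ i o, p (.coh₁ i o)) ∧ (∀ i o, p (.coh₂ i o)) ∧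
      p .aligned ∧ p .opposed := by
  refine ⟨fun h => by simp [h], fun h => ?_⟩
  rintro (_ | _ | _ | _ | _) <;> simp [h]

lemma isNormalized_toOp {W : InvariantOp} (hW : W.BlocksPos)
    (htr : ∑ i₁, ∑ o₁, ∑ i₂, ∑ o₂, W (.diag i₁ o₁ i₂ o₂) = 4) : IsNormalized (toOp W) := by
  refine ⟨hW.posSemidef_toOp, ?_⟩
  rw [trace_toOp, htr]
  norm_num

lemma parallelProjection_toOp {X : InvariantOp} {c : ℝ}
    (hX : X.replO₁.replO₂ = c • .identity) : parallelProjection (toOp X) = (c : ℂ) • 1 := by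
  rw [parallelProjection, replO₁_toOp, replO₂_toOp, hX, toOp_smul_identity]

lemma sequentialProjection_toOp {X : InvariantOp} {c : ℝ}
    (hX : X.replO₂ - X.replI₂.replO₂ + X.replO₁.replI₂.replO₂ = c • .identity) :
    sequentialProjection (toOp X) = (c : ℂ) • 1 := by
  simp only [sequentialProjection, replO₁_toOp, replI₂_toOp, replO₂_toOp]
  rw [← map_sub, ← map_add, hX, toOp_smul_identity]

lemma generalProjection_toOp {X : InvariantOp} {c : ℝ}
    (hX : X.replO₁ + X.replO₂ - X.replO₁.replO₂ - (X.replI₁.replO₁ - X.replI₁.replO₁.replO₂) -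
      (X.replI₂.replO₂ - X.replO₁.replI₂.replO₂) = c • .identity) :
    generalProjection (toOp X) = (c : ℂ) • 1 := by
  simp only [generalProjection, replI₁_toOp, replO₁_toOp, replI₂_toOp, replO₂_toOp]
  rw [← map_add, ← map_sub, ← map_sub, ← map_sub, ← map_sub, ← map_sub, hX, toOp_smul_identity]

/-- A dual certificate for the parallel testers. -/
noncomputable def parDual : InvariantOp
  | .diag i₁ o₁ i₂ o₂ =>
    !![!![0.809842, 0.000111; 0.442857, 0.343132],
        !![0.000111, 0.000111; 0.012093, 0.012093];
      !![0.442857, 0.012093; 0.378451, 0.116551],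
        !![0.343132, 0.012093; 0.116551, 0.198622]] i₁ o₁ i₂ o₂
  | .coh₁ i o | .coh₂ i o => !![0.467347, 0; 0.146846, 0.248366] i o
  | .aligned => 0.307719
  | .opposed => 0.331039

/-- The process of a nearly optimal parallel tester. -/
noncomputable def parProcess : InvariantOp
  | .diag i₁ _ i₂ _ => !![0.018305, 0.00033; 0.00033, 0.981035] i₁ i₂
  | _ => 0

/-- The first element of a nearly optimal parallel tester with process `parProcess`. -/
noncomputable def parTester : InvariantOp
  | .diag i₁ o₁ i₂ o₂ =>
    !![!![0.000565, 0.009152; 0.000008, 0.000165],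
        !![0.009152, 0.009152; 0.000165, 0.000165];
      !![0.000008, 0.000165; 0.000006, 0.980993],
        !![0.000165, 0.000165; 0.980993, 0.95151]] i₁ o₁ i₂ o₂
  | .coh₁ i o | .coh₂ i o => !![-0.000032, 0; -0.000054, 0.000236] i o
  | .aligned => 0.022702
  | .opposed => 0

/-- A dual certificate for the sequential testers. -/
noncomputable def seqDual : InvariantOp
  | .diag i₁ o₁ i₂ o₂ =>
    !![!![0.776971, 0.038511; 0.457029, 0.358453],
        !![0.000351, 0.000351; 0.000351, 0.000351];
      !![0.45706, 0.037942; 0.378451, 0.116551],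
        !![0.319896, 0.001286; 0.117619, 0.203563]] i₁ o₁ i₂ o₂
  | .coh₁ i₂ o₂ => !![0.419191, -0.007016; 0.163885, 0.24829] i₂ o₂
  | .coh₂ i₁ o₁ => !![0.426206, 0; 0.146841, 0.245793] i₁ o₁
  | .aligned => 0.280627
  | .opposed => 0.31861

/-- The process of a nearly optimal sequential tester. -/
noncomputable def seqProcess : InvariantOp
  | .diag i₁ o₁ i₂ _ =>
    ![![![0.008566, 0.003003], ![0.005785, 0.005784]],
      ![![0.000105, 0.988326], ![0.252393, 0.736038]]] i₁ o₁ i₂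
  | .coh₁ i₂ _ => ![0.046212, -0.046212] i₂
  | _ => 0

/-- The first element of a nearly optimal sequential tester with process `seqProcess`. -/
noncomputable def seqTester : InvariantOp
  | .diag i₁ o₁ i₂ o₂ =>
    !![!![0.003567, 0.004283; 0.002908, 0.001734],
        !![0.002892, 0.002892; 0.002892, 0.002892];
      !![0.000007, 0.000053; 0.000006, 0.98829],
        !![0.10573, 0.126197; 0.736004, 0.42872]] i₁ o₁ i₂ o₂
  | .coh₁ i₂ o₂ => !![0.019278, 0.023106; -0.046201, -0.026864] i₂ o₂
  | .coh₂ i₁ o₁ => !![-0.00245, 0; -0.000016, 0.212246] i₁ o₁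
  | .aligned => 0.039041
  | .opposed => -0.01332

/-- A dual certificate for the separable testers, symmetric under the exchange of the slots. -/
noncomputable def sepDual : InvariantOp
  | .diag i₁ o₁ i₂ o₂ =>
    !![!![0.7737778, 0.00000939; 0.43510136, 0.31959968],
        !![0.00000939, 0.00000485; 0.00001227, 0.00000068];
      !![0.43510136, 0.00001227; 0.37845002, 0.11679087],
        !![0.31959968, 0.00000068; 0.11679087, 0.20428739]] i₁ o₁ i₂ o₂
  | .coh₁ i o | .coh₂ i o => !![0.41400291, -0.00000188; 0.15460044, 0.24608111] i o
  | .aligned => 0.27759326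
  | .opposed => 0.31959937

/-- A majorant of `sepDual` on which all sequential processes take the same value. -/
noncomputable def seqMajorant : InvariantOp
  | .diag i₁ o₁ i₂ o₂ =>
    !![!![0.79519918, 0.02143078; 0.46606582, 0.35056414],
        !![0.00001182, 0.00000727; 0.00001534, 0.00000375];
      !![0.46516502, 0.03007592; 0.37845005, 0.11679089],
        !![0.32050355, 0.00090456; 0.1169558, 0.20445231]] i₁ o₁ i₂ o₂
  | .coh₁ i₂ o₂ => !![0.40960283, -0.00440196; 0.1568601, 0.24834077] i₂ o₂
  | .coh₂ i₁ o₁ => !![0.41400291, -0.00000188; 0.15460044, 0.24608111] i₁ o₁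
  | .aligned => 0.27759326
  | .opposed => 0.31959937

/-- A sequential process whose symmetrization is that of a nearly optimal separable tester. -/
noncomputable def sepOrdered : InvariantOp
  | .diag i₁ o₁ i₂ _ =>
    ![![![0.011198, 0.003999], ![0.00849, 0.006707]],
      ![![0.00007, 0.984733], ![0.257499, 0.727304]]] i₁ o₁ i₂
  | .coh₁ i₂ _ => ![0.053469, -0.053469] i₂
  | _ => 0

/-- The process of a nearly optimal separable tester. -/
noncomputable def sepProcess : InvariantOp :=
  (1 / 2 : ℝ) • (sepOrdered + sepOrdered.swap)

/-- The first element of a nearly optimal separable tester with process `sepProcess`. -/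
noncomputable def sepTester : InvariantOp
  | .diag i₁ o₁ i₂ o₂ =>
    !![!![0.004901, 0.004922; 0.000846, 0.05367],
        !![0.004922, 0.004245; 0.001694, 0.066051];
      !![0.000846, 0.001694; 0.000006, 0.855983],
        !![0.05367, 0.066051; 0.855983, 0.408335]] i₁ o₁ i₂ o₂
  | .coh₁ i o | .coh₂ i o => !![0.010079, 0.013367; -0.026776, 0.092247] i o
  | .aligned => 0.044693
  | .opposed => -0.011704

/-- A dual certificate for the general testers. -/
noncomputable def genDual : InvariantOp
  | .diag i₁ o₁ i₂ o₂ =>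
    !![!![0.816181, 0.000245; 0.494969, 0.321457],
        !![0.000245, 0.000128; 0.000355, 0.000018];
      !![0.494969, 0.000355; 0.378451, 0.116873],
        !![0.321457, 0.000018; 0.116873, 0.204602]] i₁ o₁ i₂ o₂
  | .coh₁ i o | .coh₂ i o => !![0.403203, -0.00005; 0.156838, 0.246315] i o
  | .aligned => 0.27606
  | .opposed => 0.32145

/-- The process of a nearly optimal general tester. -/
noncomputable def genProcess : InvariantOp
  | .diag i₁ o₁ i₂ o₂ =>
    !![!![0.01179, 0.00986; 0.00094, 0.13247],
        !![0.00986, 0.00793; 0.00287, 0.1344];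
      !![0.00094, 0.00287; 0.98633, 0.8548],
        !![0.13247, 0.1344; 0.8548, 0.72327]] i₁ o₁ i₂ o₂
  | .coh₁ i o | .coh₂ i o => !![0.02767, 0.02767; -0.02767, -0.02767] i o
  | .aligned | .opposed => 0

/-- The first element of a nearly optimal general tester with process `genProcess`. -/
noncomputable def genTester : InvariantOp
  | .diag i₁ o₁ i₂ o₂ =>
    !![!![0.00526, 0.00493; 0.0009, 0.05455],
        !![0.00493, 0.00397; 0.00143, 0.0672];
      !![0.0009, 0.00143; 0.00001, 0.85477],
        !![0.05455, 0.0672; 0.85477, 0.40083]] i₁ o₁ i₂ o₂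
  | .coh₁ i o | .coh₂ i o => !![0.01058, 0.01384; -0.02767, 0.09251] i o
  | .aligned => 0.04587
  | .opposed => -0.01169

attribute [local simp] PivotsPos schurComplement InvariantOp.BlocksPos InvariantOp.centralBlock
  InvariantOp.pairBlock InvariantOp.swap InvariantOp.replI₁ InvariantOp.replO₁ InvariantOp.replI₂
  InvariantOp.replO₂ InvariantOp.identity Entry.forall_iff Fin.forall_fin_two dampingOp dampingProb

lemma isDualFeasible_parDual : IsDualFeasible parDual := by
  constructor <;> norm_num [parDual]

lemma isParallelProcess_parProcess : IsParallelProcess (toOp parProcess) := by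
  refine ⟨isNormalized_toOp (by norm_num [parProcess]) (by norm_num [parProcess]), ?_⟩
  rw [replO₂_toOp, replO₁_toOp]
  congr 1
  norm_num [funext_iff, parProcess]

lemma lt_P_par : 8101 / 10000 < P .par := by
  refine lt_P_of_isProcess (S := .par) (T := parTester) (W := parProcess)
    isParallelProcess_parProcess (by norm_num [parTester])
    (by norm_num [parTester, parProcess]) ?_
  rintro s₁ ⟨_, _⟩ s₂ ⟨_, _⟩
  norm_num [InvariantOp.pairing, parTester, parProcess]
  linarith

lemma P_par_lt : P .par < 8102 / 10000 := by
  refine (isDualFeasible_parDual.P_le (c := 0.810175) fun W hW => ?_).trans_lt (by norm_num)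
  have projection : parallelProjection (toOp parDual) = ((0.20254375 : ℝ) : ℂ) • 1 :=
    parallelProjection_toOp (by norm_num [funext_iff, parDual])
  rw [hW.trace_mul projection]
  norm_num

lemma isDualFeasible_seqDual : IsDualFeasible seqDual := by
  constructor <;> norm_num [seqDual]

lemma isSequentialProcess_seqProcess : IsSequentialProcess (toOp seqProcess) := by
  refine ⟨isNormalized_toOp (by norm_num [seqProcess]) (by norm_num [seqProcess]), ?_, ?_⟩ <;>
  · simp only [replO₁_toOp, replI₂_toOp, replO₂_toOp]
    congr 1
    norm_num [funext_iff, seqProcess]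

lemma lt_P_seq : 8161 / 10000 < P .seq := by
  refine lt_P_of_isProcess (S := .seq) (T := seqTester) (W := seqProcess)
    isSequentialProcess_seqProcess (by norm_num [seqTester])
    (by norm_num [seqTester, seqProcess]) ?_
  rintro s₁ ⟨_, _⟩ s₂ ⟨_, _⟩
  norm_num [InvariantOp.pairing, seqTester, seqProcess]
  linarith

lemma P_seq_lt : P .seq < 8162 / 10000 := by
  refine (isDualFeasible_seqDual.P_le (c := 0.816184) fun W hW => ?_).trans_lt (by norm_num)
  have projection : sequentialProjection (toOp seqDual) = ((0.204046 : ℝ) : ℂ) • 1 :=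
    sequentialProjection_toOp (by norm_num [funext_iff, seqDual])
  rw [hW.trace_mul projection]
  norm_num

lemma isDualFeasible_sepDual : IsDualFeasible sepDual := by
  constructor <;> norm_num [sepDual]

lemma sepDual_swap : sepDual.swap = sepDual := by
  norm_num [funext_iff, sepDual]

lemma IsSequentialProcess.trace_mul_sepDual_re_le {V : Op (Fin 2) (Fin 2) (Fin 2) (Fin 2)}
    (hV : IsSequentialProcess V) : (V * toOp sepDual).trace.re ≤ 0.81664905 := by
  have projection : sequentialProjection (toOp seqMajorant) = ((0.2041622625 : ℝ) : ℂ) • 1 :=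
    sequentialProjection_toOp (by norm_num [funext_iff, seqMajorant])
  have gap_pos : (seqMajorant - sepDual).BlocksPos := by norm_num [seqMajorant, sepDual]
  have gap_nonneg :=
    (Complex.nonneg_iff.mp (trace_mul_nonneg_of_posSemidef hV.1.1 gap_pos.posSemidef_toOp)).1
  rw [map_sub, Matrix.mul_sub, Matrix.trace_sub, Complex.sub_re, hV.trace_mul projection]
    at gap_nonneg
  norm_num at gap_nonneg ⊢
  linarith

lemma isSeparableProcess_sepProcess : IsSeparableProcess (toOp sepProcess) := by
  have ordered : IsSequentialProcess (toOp sepOrdered) := by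
    refine ⟨isNormalized_toOp (by norm_num [sepOrdered]) (by norm_num [sepOrdered]), ?_, ?_⟩ <;>
    · simp only [replO₁_toOp, replI₂_toOp, replO₂_toOp]
      congr 1
      norm_num [funext_iff, sepOrdered]
  convert ordered.isSeparableProcess_symmetrize using 1
  rw [swapSlots_toOp, ← map_add, sepProcess, map_smul, ← Complex.coe_smul]
  norm_num

lemma lt_P_sep : 8166 / 10000 < P .sep := by
  refine lt_P_of_isProcess (S := .sep) (T := sepTester) (W := sepProcess)
    isSeparableProcess_sepProcess (by norm_num [sepTester])
    (by norm_num [sepTester, sepProcess, sepOrdered]) ?_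
  rintro s₁ ⟨_, _⟩ s₂ ⟨_, _⟩
  norm_num [InvariantOp.pairing, sepTester, sepProcess, sepOrdered]
  linarith

lemma P_sep_lt : P .sep < 81665 / 100000 := by
  refine (isDualFeasible_sepDual.P_le (c := 0.81664905) fun _ hW => ?_).trans_lt (by norm_num)
  exact hW.trace_mul_re_le (by rw [swapSlots_toOp, sepDual_swap])
    fun _ hV => hV.trace_mul_sepDual_re_le

lemma isDualFeasible_genDual : IsDualFeasible genDual := by
  constructor <;> norm_num [genDual]

lemma isGeneralProcess_genProcess : IsGeneralProcess (toOp genProcess) := by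
  refine ⟨isNormalized_toOp (by norm_num [genProcess]) (by norm_num [genProcess]), ?_, ?_, ?_⟩ <;>
  · simp only [replI₁_toOp, replO₁_toOp, replI₂_toOp, replO₂_toOp, ← map_add, ← map_sub]
    congr 1
    norm_num [funext_iff, genProcess]

lemma lt_P_gen : 8167 / 10000 < P .gen := by
  refine lt_P_of_isProcess (S := .gen) (T := genTester) (W := genProcess)
    isGeneralProcess_genProcess (by norm_num [genTester])
    (by norm_num [genTester, genProcess]) ?_
  rintro s₁ ⟨_, _⟩ s₂ ⟨_, _⟩
  norm_num [InvariantOp.pairing, genTester, genProcess]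
  linarith

lemma P_gen_lt : P .gen < 8168 / 10000 := by
  refine (isDualFeasible_genDual.P_le (c := 0.816799) fun W hW => ?_).trans_lt (by norm_num)
  have projection : generalProjection (toOp genDual) = ((0.20419975 : ℝ) : ℂ) • 1 :=
    generalProjection_toOp (by norm_num [funext_iff, genDual])
  rw [hW.trace_mul projection]
  norm_num

end Certificates

end ChannelDiscrimination

theorem mainTheorem2 :
    (∀ S : ChannelDiscrimination.Strategy,
      IsGreatest
        (ChannelDiscrimination.successProbabilities S (fun _ => 1 / 2)
          ChannelDiscrimination.twoDampings)
        (ChannelDiscrimination.P S)) ∧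
    (ChannelDiscrimination.P .par < ChannelDiscrimination.P .seq ∧
      ChannelDiscrimination.P .seq < ChannelDiscrimination.P .sep ∧
      ChannelDiscrimination.P .sep < ChannelDiscrimination.P .gen) ∧
    (8101 / 10000 < ChannelDiscrimination.P .par ∧
      ChannelDiscrimination.P .par < 8102 / 10000) ∧
    (8161 / 10000 < ChannelDiscrimination.P .seq ∧
      ChannelDiscrimination.P .seq < 8162 / 10000) ∧
    (8166 / 10000 < ChannelDiscrimination.P .sep ∧
      ChannelDiscrimination.P .sep < 81665 / 100000) ∧
    (8167 / 10000 < ChannelDiscrimination.P .gen ∧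
      ChannelDiscrimination.P .gen < 8168 / 10000) := by
  open ChannelDiscrimination in
  refine ⟨fun S => isGreatest_maxSuccess S _ _, ⟨?_, ?_, ?_⟩, ⟨lt_P_par, P_par_lt⟩,
    ⟨lt_P_seq, P_seq_lt⟩, ⟨lt_P_sep, P_sep_lt⟩, lt_P_gen, P_gen_lt⟩
  · exact P_par_lt.trans (lt_trans (by norm_num) lt_P_seq)
  · exact P_seq_lt.trans (lt_trans (by norm_num) lt_P_sep)
  · exact P_sep_lt.trans (lt_trans (by norm_num) lt_P_gen)
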